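/- For subsets $A,B$ of a finite abelian group $G$ (written additively), let $\Delta(A,B)$ be the multiset $\{x-y : x\in A,\ y\in B\}$. Let $G$ have order $v$, let $\lambda_1,\dots,\lambda_r$ be positive integers, and let $D_1,\dots,D_r$ be mutually disjoint subsets of $G$ with $|D_i|=k_i$. The family $\{D_1,\dots,D_r\}$ is called a $(v,r;k_1,\dots,k_r;\lambda_1,\dots,\lambda_r)$-GSEDF (generalized strong external difference family) in $G$ if, for every $1\le i\le r$, the multiset equation $\bigcup_{j\neq i}\Delta(D_i,D_j)=\lambda_i\,(G\setminus\{0\})$ holds, where multiplicities are added in the union; that is, every nonzero element of $G$ occurs exactly $\lambda_i$ times on the left, and $0$ does not occur. Such a GSEDF is said to exist if it exists in some abelian group of order $v$. Theorem. Let $m\ge 1$ be an integer. Let $t=1$ and $n=0$, or let $t=p_1p_2\cdots p_n$ where $p_1,\dots,p_n$ are odd integers greater than $1$ (not necessarily prime or distinct). Suppose that $4m-1$ is a prime power, or that $4m-1=q(q+2)$ where both $q$ and $q+2$ are prime powers. Then there exists a $\left((4m-1)t,\,2;\ m\cdot 2^{n+1},\ \frac{4mt-t-1}{2};\ m\cdot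 2^{n},\ m\cdot 2^{n}\right)$-GSEDF. -/

import Mathlib

/-- The multiset of differences `Δ(A, B) = {x - y : x ∈ A, y ∈ B}`, counted with multiplicity. -/
def diffMultiset {G : Type*} [AddCommGroup G] (A B : Finset G) : Multiset G :=
  (A ×ˢ B).val.map (fun p => p.1 - p.2)

/-- `D 0, …, D (m - 1)` is a `(v, m; k₁, …, kₘ; lam₁, …, lamₘ)`-generalized strong external
difference family in the finite abelian group `G`. The union of multisets in the defining
equation adds multiplicities. -/
structure IsGSEDF {G : Type*} [AddCommGroup G] [Fintype G] [DecidableEq G]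
    (v m : ℕ) (k lam : Fin m → ℕ) (D : Fin m → Finset G) : Prop where
  card_group : Fintype.card G = v
  lam_pos : ∀ i, 0 < lam i
  disjoint : ∀ i j, i ≠ j → Disjoint (D i) (D j)
  card_block : ∀ i, (D i).card = k i
  diff_eq : ∀ i, ∑ j ∈ Finset.univ.erase i, diffMultiset (D i) (D j)
    = lam i • (Finset.univ.erase (0 : G)).val

/-- A `(v, m; k₁, …, kₘ; lam₁, …, lamₘ)`-GSEDF exists in some abelian group. -/
def GSEDFExists (v m : ℕ) (k lam : Fin m → ℕ) : Prop :=
  ∃ (G : Type) (_ : AddCommGroup G) (_ : Fintype G) (_ : DecidableEq G) (D : Fin m → Finset G),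
    IsGSEDF v m k lam D

/-! A ±1 function on a group of order `4m - 1` with sum -1 and all nontrivial autocorrelations -1
splits the group into a pair satisfying `IsDifferencePair` (`of_autocorrelation`). Adjusted
quadratic characters supply such functions on a field (Paley) and on a product of two fields (twin
prime powers). Each odd factor `p` is then absorbed by `prod_zmod`: doubling `A` across two layers
of `ZMod p`, while the layers of `B` alternate between `B` and its complement, doubles `lam` and
keeps the size relations, so induction on `n` finishes. -/

open Finset in
/-- Every nonzero element of `G` is `lam` times a difference of `A` and `B`, zero is not such a
difference, `A` has `2 * lam` elements and `B` has `(|G| - 1) / 2`. -/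
structure IsDifferencePair {G : Type*} [AddCommGroup G] [Fintype G] [DecidableEq G]
    (A B : Finset G) (lam : ℕ) : Prop where
  card_filter_sub_mem : ∀ g, #{a ∈ A | a - g ∈ B} = if g = 0 then 0 else lam
  card_left : #A = 2 * lam
  card_right : 2 * #B + 1 = Fintype.card G

/-! ### From difference pairs to GSEDFs -/

theorem count_diffMultiset {G : Type*} [AddCommGroup G] [DecidableEq G] (A B : Finset G) (g : G) :
    (diffMultiset A B).count g = (A.filter fun a => a - g ∈ B).card := by
  rw [diffMultiset, Multiset.count_map, ← Finset.filter_val, Finset.card_val]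
  refine Finset.card_bij' (fun p _ => p.1) (fun a _ => (a, a - g)) ?_ ?_ ?_ ?_
  · rintro ⟨a, b⟩ h
    simp only [Finset.mem_filter, Finset.mem_product] at h ⊢
    obtain ⟨⟨ha, hb⟩, rfl⟩ := h
    simpa [ha] using hb
  · intro a h
    simpa using h
  · rintro ⟨a, b⟩ h
    simp only [Finset.mem_filter, Finset.mem_product] at h ⊢
    obtain ⟨⟨ha, hb⟩, rfl⟩ := h
    simp
  · intro a h
    rfl

theorem count_diffMultiset_swap {G : Type*} [AddCommGroup G] [DecidableEq G] (A B : Finset G)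
    (g : G) : (diffMultiset B A).count g = (diffMultiset A B).count (-g) := by
  rw [count_diffMultiset, count_diffMultiset]
  refine Finset.card_bij' (fun b _ => b - g) (fun a _ => a + g) ?_ ?_ ?_ ?_ <;>
    simp +contextual

theorem count_smul_erase_zero {G : Type*} [AddCommGroup G] [Fintype G] [DecidableEq G] (lam : ℕ)
    (g : G) : (lam • (Finset.univ.erase (0 : G)).val).count g = if g = 0 then 0 else lam := by
  rw [Multiset.count_nsmul]
  split_ifs with h
  · subst h
    simp
  · rw [Multiset.count_eq_one_of_mem (Finset.nodup _) (Finset.mem_erase.mpr ⟨h, Finset.mem_univ g⟩)]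
    simp

namespace IsDifferencePair

variable {G : Type*} [AddCommGroup G] [Fintype G] [DecidableEq G] {A B : Finset G} {lam : ℕ}

theorem diffMultiset_eq (h : IsDifferencePair A B lam) :
    diffMultiset A B = lam • (Finset.univ.erase (0 : G)).val := by
  ext g
  rw [count_diffMultiset, h.card_filter_sub_mem, count_smul_erase_zero]

/-- Swapping the sets negates every difference, and the nonzero elements are closed under negation;
one equation thus gives both. -/
theorem diffMultiset_swap_eq (h : IsDifferencePair A B lam) :
    diffMultiset B A = lam • (Finset.univ.erase (0 : G)).val := by
  ext g
  rw [count_diffMultiset_swap, count_diffMultiset, h.card_filter_sub_mem, count_smul_erase_zero]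
  simp

theorem disjoint (h : IsDifferencePair A B lam) : Disjoint A B := by
  have h0 := h.card_filter_sub_mem 0
  rw [if_pos rfl, Finset.card_eq_zero, Finset.filter_eq_empty_iff] at h0
  exact Finset.disjoint_left.mpr fun a ha hb => h0 ha (by simpa using hb)

theorem isGSEDF (h : IsDifferencePair A B lam) (hlam : 0 < lam) :
    IsGSEDF (Fintype.card G) 2 ![2 * lam, (Fintype.card G - 1) / 2] ![lam, lam] ![A, B] where
  card_group := rfl
  lam_pos i := by fin_cases i <;> exact hlam
  disjoint i j hij := by
    fin_cases i <;> fin_cases j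
    · exact absurd rfl hij
    · exact h.disjoint
    · exact h.disjoint.symm
    · exact absurd rfl hij
  card_block i := by
    have := h.card_left
    have := h.card_right
    fin_cases i
    · exact h.card_left
    · change B.card = (Fintype.card G - 1) / 2
      omega
  diff_eq i := by
    fin_cases i
    · change ∑ j ∈ Finset.univ.erase (0 : Fin 2), diffMultiset A (![A, B] j) = lam • _
      rw [show Finset.univ.erase (0 : Fin 2) = {1} by decide, Finset.sum_singleton]
      exact h.diffMultiset_eq
    · change ∑ j ∈ Finset.univ.erase (1 : Fin 2), diffMultiset B (![A, B] j) = lam • _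
      rw [show Finset.univ.erase (1 : Fin 2) = {0} by decide, Finset.sum_singleton]
      exact h.diffMultiset_swap_eq

end IsDifferencePair

/-! ### Adjoining an odd cyclic factor -/

theorem ZMod.card_filter_even_val_neg (s : ℕ) :
    (Finset.univ.filter fun i : ZMod (2 * s + 1) => Even (-i).val).card = s + 1 := by
  rw [show s + 1 = (Finset.range (s + 1)).card by simp]
  refine Finset.card_bij' (fun i _ => (-i).val / 2)
    (fun j _ => -((2 * j : ℕ) : ZMod (2 * s + 1))) ?_ ?_ ?_ ?_
  · intro i _
    have := (-i).val_lt
    simp only [Finset.mem_range]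
    omega
  · intro j hj
    have : j < s + 1 := by simpa using hj
    simp only [Finset.mem_filter, Finset.mem_univ, true_and, neg_neg]
    rw [ZMod.val_natCast_of_lt (by omega)]
    exact even_two_mul j
  · intro i hi
    simp only [Finset.mem_filter, Finset.mem_univ, true_and] at hi
    rw [Nat.two_mul_div_two_of_even hi, ZMod.natCast_zmod_val, neg_neg]
  · intro j hj
    have : j < s + 1 := by simpa using hj
    simp only [neg_neg]
    rw [ZMod.val_natCast_of_lt (by omega)]
    omega

/-- Subtracting 1 flips parity except at the wraparound from 0 to `p - 1`, both even since `p` is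
odd. -/
theorem ZMod.even_val_sub_one_iff {p : ℕ} [NeZero p] (hp : Odd p) (hp1 : 1 < p) (j : ZMod p) :
    Even (j - 1).val ↔ (Even j.val ↔ j = 0) := by
  have : Fact (1 < p) := ⟨hp1⟩
  by_cases hj : j = 0
  · subst hj
    have h : (0 - 1 : ZMod p).val = p - 1 := by
      obtain ⟨k, rfl⟩ : ∃ k, p = k + 1 := ⟨p - 1, by omega⟩
      rw [zero_sub, ZMod.val_neg_one]
      rfl
    rw [h]
    have := hp.tsub_odd odd_one
    simp [this]
  · have hpos : 1 ≤ j.val := Nat.one_le_iff_ne_zero.mpr (by simpa [ZMod.val_eq_zero] using hj)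
    have h : (j - 1).val = j.val - 1 := by
      rw [ZMod.val_sub (by rwa [ZMod.val_one]), ZMod.val_one]
    rw [h, Nat.even_sub hpos]
    simp [hj]

open Finset in
theorem IsDifferencePair.prod_zmod {G : Type*} [AddCommGroup G] [Fintype G] [DecidableEq G]
    {A B : Finset G} {lam p : ℕ} [NeZero p] (h : IsDifferencePair A B lam) (hp : Odd p)
    (hp1 : 1 < p) :
    IsDifferencePair (A ×ˢ ({0, 1} : Finset (ZMod p)))
      ({x | Even (-x.2).val ↔ x.1 ∈ B} : Finset (G × ZMod p)) (2 * lam) := by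
  have : Fact (1 < p) := ⟨hp1⟩
  have h01 : (0 : ZMod p) ≠ 1 := zero_ne_one
  refine ⟨?_, ?_, ?_⟩
  · rintro ⟨g, j⟩
    rw [card_filter, sum_product_right, sum_pair h01]
    simp only [mem_filter, mem_univ, true_and, Prod.mk_sub_mk, neg_sub, sub_zero,
      ZMod.even_val_sub_one_iff hp hp1]
    simp only [← card_filter]
    -- For `j = 0` both layers test `a - g ∈ B`, doubling the old count. Otherwise one layer tests
    -- membership and the other non-membership, so each `a ∈ A` counts exactly once, giving `#A = 2
    -- * lam`.
    by_cases hj : j = 0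
    · subst hj
      have := h.card_filter_sub_mem g
      simp only [ZMod.val_zero, Even.zero, true_iff, this, Prod.mk_eq_zero, and_true]
      split_ifs <;> omega
    · have hc : ∀ b : Prop, (Even j.val ↔ j = 0) ↔ ¬ Even j.val := by simp [hj]
      have := h.card_left
      simp only [hj, iff_false, Prod.mk_eq_zero, and_false, if_false]
      rw [← this, ← card_filter_add_card_filter_not (s := A) (fun a => Even j.val ↔ a - g ∈ B)]
      congr 2
      ext a
      simp only [mem_filter]
      tauto
  · rw [card_product, card_pair h01, h.card_left]
    ring
  · obtain ⟨s, rfl⟩ := hp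
    have h1 := ZMod.card_filter_even_val_neg s
    have h2 := card_filter_add_card_filter_not (s := (univ : Finset (ZMod (2 * s + 1))))
      (fun i => Even (-i).val)
    rw [card_univ, ZMod.card, h1] at h2
    have h3 := h.card_right
    have h4 := card_compl_add_card B
    have hB : ∀ i : ZMod (2 * s + 1), #{x : G | Even (-i).val ↔ x ∈ B}
        = if Even (-i).val then #B else #Bᶜ := by
      intro i
      split_ifs with hi <;> congr 1 <;> ext x <;> simp [hi]
    have : #({x | Even (-x.2).val ↔ x.1 ∈ B} : Finset (G × ZMod (2 * s + 1)))
        = (s + 1) * #B + s * #Bᶜ := by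
      rw [card_filter, ← univ_product_univ, sum_product_right]
      simp only [← card_filter, hB]
      rw [sum_ite, sum_const, sum_const, h1, smul_eq_mul, smul_eq_mul]
      congr 2
      omega
    rw [this, Fintype.card_prod, ZMod.card, ← h3, show #Bᶜ = #B + 1 by omega]
    ring

/-! ### Difference pairs from autocorrelation -/

open Finset in
/-- A `±1`-valued function with sum `-1` whose nontrivial autocorrelations are `-1`
is the signed indicator function of a difference set. -/
theorem IsDifferencePair.of_autocorrelation {G : Type*} [AddCommGroup G] [Fintype G]
    [DecidableEq G] {m : ℕ} (hm : Fintype.card G + 1 = 4 * m) (f : G → ℤ)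
    (hf : ∀ x, f x = 1 ∨ f x = -1) (hsum : ∑ x, f x = -1)
    (hcorr : ∀ g, g ≠ 0 → ∑ x, f x * f (x - g) = -1) :
    IsDifferencePair ({x | f x ≠ 1} : Finset G) ({x | f x = 1} : Finset G) m := by
  have hm' : (Fintype.card G : ℤ) + 1 = 4 * m := mod_cast hm
  have hB : 2 * (#({x | f x = 1} : Finset G) : ℤ) = Fintype.card G - 1 := by
    have : ∑ x, (1 + f x) = 2 * (#({x | f x = 1} : Finset G) : ℤ) := by
      rw [card_filter, Nat.cast_sum, mul_sum]
      refine sum_congr rfl fun x _ => ?_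
      rcases hf x with h | h <;> simp [h]
    rw [← this, sum_add_distrib, hsum]
    simp
    rfl
  have hAB := card_filter_add_card_filter_not (s := (univ : Finset G)) (fun x => f x = 1)
  rw [card_univ] at hAB
  refine ⟨fun g => ?_, ?_, ?_⟩
  · by_cases hg : g = 0
    · subst hg
      rw [if_pos rfl, card_eq_zero, filter_eq_empty_iff]
      simp
    · rw [if_neg hg]
      have hshift : ∑ x, f (x - g) = -1 := by
        rw [← hsum]
        exact (Equiv.subRight g).sum_comp f
      -- Each summand is 4 when `x` and `x - g` lie in the two respective sets, and 0 otherwise.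
      have key : ∑ x, (1 - f x) * (1 + f (x - g))
          = 4 * (#{a ∈ ({x | f x ≠ 1} : Finset G) | a - g ∈ ({x | f x = 1} : Finset G)} : ℤ) := by
        rw [filter_filter, card_filter, Nat.cast_sum, mul_sum]
        refine sum_congr rfl fun x _ => ?_
        rcases hf x with h | h <;> rcases hf (x - g) with h' | h' <;> simp [h, h']
      have : ∑ x, (1 - f x) * (1 + f (x - g)) = Fintype.card G + 1 := by
        simp only [show ∀ x, (1 - f x) * (1 + f (x - g))
          = 1 - f x + f (x - g) - f x * f (x - g) from fun x => by ring]
        rw [sum_sub_distrib, sum_add_distrib, sum_sub_distrib, hsum, hshift, hcorr g hg]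
        simp
      omega
  · simp only [ne_eq]
    omega
  · omega

/-! ### Paley and twin prime power constructions -/

section QuadraticChar

variable {F : Type*} [Field F] [Fintype F] [DecidableEq F]

/-- Scaling `x = g * y` turns the sum into `χ(-1)` times the Jacobi sum of `χ` with its inverse,
which is `-χ(-1)`. -/
theorem quadraticChar_autocorrelation (hF : ringChar F ≠ 2) {g : F} (hg : g ≠ 0) :
    ∑ x, quadraticChar F x * quadraticChar F (x - g) = -1 := by
  have hJ := jacobiSum_nontrivial_inv (quadraticChar_ne_one hF)
  rw [(quadraticChar_isQuadratic F).inv, jacobiSum] at hJ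
  rw [← Equiv.sum_comp (Equiv.mulLeft₀ g hg)]
  have hterm : ∀ y : F, quadraticChar F (g * y) * quadraticChar F (g * y - g)
      = quadraticChar F (-1) * (quadraticChar F y * quadraticChar F (1 - y)) := by
    intro y
    rw [show g * y - g = g * (-1 * (1 - y)) by ring]
    simp only [map_mul]
    linear_combination (quadraticChar F y * quadraticChar F (-1) * quadraticChar F (1 - y)) *
      quadraticChar_sq_one hg
  simp only [Equiv.mulLeft₀_apply, hterm]
  rw [← Finset.mul_sum, hJ]
  linear_combination -quadraticChar_sq_one (F := F) (neg_ne_zero.mpr one_ne_zero)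

theorem sum_quadraticChar_mul_self :
    ∑ x, quadraticChar F x * quadraticChar F x = Fintype.card F - 1 := by
  have hterm : ∀ x : F, quadraticChar F x * quadraticChar F x = 1 - if x = 0 then 1 else 0 := by
    intro x
    by_cases hx : x = 0
    · simp [hx]
    · rw [← sq, quadraticChar_sq_one hx, if_neg hx, sub_zero]
  simp [-quadraticChar_apply, hterm, Finset.sum_sub_distrib]

omit [DecidableEq F] in
theorem ringChar_ne_two_of_odd_card (h : Odd (Fintype.card F)) : ringChar F ≠ 2 := by
  intro h2
  have := FiniteField.even_card_of_char_two h2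
  rw [Nat.odd_iff] at h
  omega

theorem quadraticChar_neg_one_of_card_mod_four_eq_three (h : Fintype.card F % 4 = 3) :
    quadraticChar F (-1) = -1 := by
  rw [quadraticChar_neg_one (ringChar_ne_two_of_odd_card (Nat.odd_iff.mpr (by omega))),
    ZMod.χ₄_nat_three_mod_four h]

theorem quadraticChar_neg_one_of_card_mod_four_eq_one (h : Fintype.card F % 4 = 1) :
    quadraticChar F (-1) = 1 := by
  rw [quadraticChar_neg_one (ringChar_ne_two_of_odd_card (Nat.odd_iff.mpr (by omega))),
    ZMod.χ₄_nat_one_mod_four h]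

open Finset in
/-- The Paley difference set. -/
theorem exists_isDifferencePair_field {m : ℕ} (h : Fintype.card F + 1 = 4 * m) :
    ∃ A B : Finset F, IsDifferencePair A B m := by
  have hF : ringChar F ≠ 2 := ringChar_ne_two_of_odd_card (Nat.odd_iff.mpr (by omega))
  have hneg := quadraticChar_neg_one_of_card_mod_four_eq_three (F := F) (by omega)
  -- The value at 0 is set to -1; the resulting cross terms `χ(g)` and `χ(-g)` cancel because `χ(-1)
  -- = -1`.
  refine ⟨_, _, IsDifferencePair.of_autocorrelation h
    (fun x => quadraticChar F x - if x = 0 then 1 else 0) (fun x => ?_) ?_ fun g hg => ?_⟩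
  · by_cases hx : x = 0
    · simp [hx]
    · simpa [hx] using quadraticChar_dichotomy hx
  · simp [-quadraticChar_apply, quadraticChar_sum_zero hF]
  · have hodd : quadraticChar F (-g) = -quadraticChar F g := by
      rw [neg_eq_neg_one_mul, map_mul, hneg, neg_one_mul]
    simp [-quadraticChar_apply, sub_mul, mul_sub, sub_eq_zero, quadraticChar_autocorrelation hF hg, hg, hodd]

variable {K : Type*} [Field K] [Fintype K] [DecidableEq K]

open Finset in
/-- The twin prime power difference set. -/
theorem exists_isDifferencePair_prod {m : ℕ} (hodd : Odd (Fintype.card F))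
    (hK : Fintype.card K = Fintype.card F + 2)
    (h : Fintype.card F * Fintype.card K + 1 = 4 * m) :
    ∃ A B : Finset (F × K), IsDifferencePair A B m := by
  have hF : ringChar F ≠ 2 := ringChar_ne_two_of_odd_card hodd
  have hK2 : ringChar K ≠ 2 := ringChar_ne_two_of_odd_card (by rw [hK]; exact hodd.add_even even_two)
  -- Of two odd numbers differing by 2, exactly one is 3 mod 4.
  have hneg : quadraticChar F (-1) * quadraticChar K (-1) = -1 := by
    rcases Nat.odd_mod_four_iff.mp (Nat.odd_iff.mp hodd) with h1 | h3
    · rw [quadraticChar_neg_one_of_card_mod_four_eq_one h1,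
        quadraticChar_neg_one_of_card_mod_four_eq_three (by omega)]
      rfl
    · rw [quadraticChar_neg_one_of_card_mod_four_eq_three h3,
        quadraticChar_neg_one_of_card_mod_four_eq_one (by omega)]
      rfl
  have hsep : ∀ (u : F → ℤ) (v : K → ℤ), ∑ x : F × K, u x.1 * v x.2 = (∑ x, u x) * ∑ y, v y :=
    fun u v => by rw [Fintype.sum_prod_type, Fintype.sum_mul_sum]
  have hcard : (Fintype.card K : ℤ) = Fintype.card F + 2 := mod_cast hK
  -- The zeros of `χψ` are filled with +1 on `y = 0` (origin included) and -1 on the rest of `x =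
  -- 0`; with `|K| = |F| + 2` the sum is -1.
  refine ⟨_, _, IsDifferencePair.of_autocorrelation (by rwa [Fintype.card_prod])
    (fun x : F × K => quadraticChar F x.1 * quadraticChar K x.2
      + (if x.2 = 0 then 1 else 0) - (if x.1 = 0 then 1 else 0) * (1 - if x.2 = 0 then 1 else 0))
    (fun x => ?_) ?_ ?_⟩
  · by_cases hx : x.1 = 0
    · by_cases hy : x.2 = 0 <;> simp [hx, hy]
    · by_cases hy : x.2 = 0
      · simp [hx, hy]
      · rcases quadraticChar_dichotomy hx with h1 | h1 <;>
          rcases quadraticChar_dichotomy hy with h2 | h2 <;> rw [h1, h2] <;> simp [hx, hy]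
  · rw [sum_sub_distrib, sum_add_distrib, hsep, hsep (fun x => if x = 0 then 1 else 0)
      (fun y => 1 - if y = 0 then 1 else 0), quadraticChar_sum_zero hF]
    have := hsep (fun _ => 1) (fun y => if y = 0 then 1 else 0)
    simp only [one_mul] at this
    rw [this]
    simp
    omega
  · rintro ⟨a, b⟩ hg
    set χ := quadraticChar F with hχ
    set ψ := quadraticChar K with hψ
    have hsum1 : ∑ x, χ x = 0 := quadraticChar_sum_zero hF
    have hsum2 : ∑ y, ψ y = 0 := quadraticChar_sum_zero hK2
    have hshift1 : ∑ x, χ (x - a) = 0 := hsum1 ▸ (Equiv.subRight a).sum_comp χ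
    have hshift2 : ∑ y, ψ (y - b) = 0 := hsum2 ▸ (Equiv.subRight b).sum_comp ψ
    have hneg' : χ (-a) * ψ (-b) = -(χ a * ψ b) := by
      rw [neg_eq_neg_one_mul a, neg_eq_neg_one_mul b, map_mul, map_mul]
      linear_combination χ a * ψ b * hneg
    -- Each term is a function of `x.1` times a function of `x.2`, so `hsep` factors its sum.
    have hexp : ∀ x : F × K,
        (χ x.1 * ψ x.2 + (if x.2 = 0 then 1 else 0)
          - (if x.1 = 0 then 1 else 0) * (1 - if x.2 = 0 then 1 else 0))
        * (χ (x - (a, b)).1 * ψ (x - (a, b)).2 + (if (x - (a, b)).2 = 0 then 1 else 0)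
          - (if (x - (a, b)).1 = 0 then 1 else 0) * (1 - if (x - (a, b)).2 = 0 then 1 else 0))
        = (χ x.1 * χ (x.1 - a)) * (ψ x.2 * ψ (x.2 - b))
          + χ x.1 * (ψ x.2 * if x.2 = b then 1 else 0)
          - (χ x.1 * if x.1 = a then 1 else 0) * (ψ x.2 * (1 - if x.2 = b then 1 else 0))
          + χ (x.1 - a) * ((if x.2 = 0 then 1 else 0) * ψ (x.2 - b))
          + 1 * ((if x.2 = 0 then 1 else 0) * if x.2 = b then 1 else 0)
          - (if x.1 = a then 1 else 0)
            * ((if x.2 = 0 then 1 else 0) * (1 - if x.2 = b then 1 else 0))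
          - ((if x.1 = 0 then 1 else 0) * χ (x.1 - a))
            * ((1 - if x.2 = 0 then 1 else 0) * ψ (x.2 - b))
          - (if x.1 = 0 then 1 else 0)
            * ((1 - if x.2 = 0 then 1 else 0) * if x.2 = b then 1 else 0)
          + ((if x.1 = 0 then 1 else 0) * if x.1 = a then 1 else 0)
            * ((1 - if x.2 = 0 then 1 else 0) * (1 - if x.2 = b then 1 else 0)) := by
      intro x
      simp only [Prod.fst_sub, Prod.snd_sub, sub_eq_zero]
      ring
    simp only [hexp, sum_add_distrib, sum_sub_distrib]
    rw [hsep (fun x => χ x * χ (x - a)) (fun y => ψ y * ψ (y - b)),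
      hsep (fun x => χ x) (fun y => ψ y * if y = b then 1 else 0),
      hsep (fun x => χ x * if x = a then 1 else 0) (fun y => ψ y * (1 - if y = b then 1 else 0)),
      hsep (fun x => χ (x - a)) (fun y => (if y = 0 then 1 else 0) * ψ (y - b)),
      hsep (fun _ => 1) (fun y => (if y = 0 then 1 else 0) * if y = b then 1 else 0),
      hsep (fun x => if x = a then 1 else 0)
        (fun y => (if y = 0 then 1 else 0) * (1 - if y = b then 1 else 0)),
      hsep (fun x => (if x = 0 then 1 else 0) * χ (x - a))
        (fun y => (1 - if y = 0 then 1 else 0) * ψ (y - b)),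
      hsep (fun x => if x = 0 then 1 else 0)
        (fun y => (1 - if y = 0 then 1 else 0) * if y = b then 1 else 0),
      hsep (fun x => (if x = 0 then 1 else 0) * if x = a then 1 else 0)
        (fun y => (1 - if y = 0 then 1 else 0) * (1 - if y = b then 1 else 0)),
      hsum1, hshift1]
    simp only [mul_sub, sub_mul, sum_sub_distrib, mul_one, one_mul, mul_ite, ite_mul, mul_zero,
      zero_mul, sum_ite_eq', mem_univ, if_true, zero_sub, hsum2, hshift2, sum_const, card_univ,
      nsmul_eq_mul]
    -- On the axes `|K| = |F| + 2` balances the sum; off them the cross terms cancel by `hneg'`.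
    by_cases ha : a = 0
    · have hb : b ≠ 0 := fun hb => hg (by rw [ha, hb]; rfl)
      subst ha
      simp only [sub_zero, neg_zero, hχ, hψ, sum_quadraticChar_mul_self,
        quadraticChar_autocorrelation hK2 hb,
        hb, if_true, if_false, quadraticChar_zero]
      linear_combination hcard
    · by_cases hb : b = 0
      · subst hb
        simp only [sub_zero, neg_zero, hχ, hψ, sum_quadraticChar_mul_self,
          quadraticChar_autocorrelation hF ha, ha, if_true, if_false,
          quadraticChar_zero]
        linear_combination -hcard
      · rw [quadraticChar_autocorrelation hF ha, quadraticChar_autocorrelation hK2 hb]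
        simp only [ha, hb, if_false]
        linear_combination hneg'

end QuadraticChar

/-! ### Assembly and induction on the odd factors -/

theorem exists_field_of_isPrimePow {q : ℕ} (hq : IsPrimePow q) :
    ∃ (F : Type) (_ : Field F) (_ : Fintype F), Fintype.card F = q := by
  obtain ⟨p, k, hp, hk, rfl⟩ := hq
  have : Fact p.Prime := ⟨hp.nat_prime⟩
  let _ := Fintype.ofFinite (GaloisField p k)
  refine ⟨GaloisField p k, inferInstance, inferInstance, ?_⟩
  rw [← Nat.card_eq_fintype_card, GaloisField.card p k hk.ne']

theorem exists_isDifferencePair {m : ℕ} (hm : 0 < m)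
    (hv : IsPrimePow (4 * m - 1) ∨
      ∃ q : ℕ, IsPrimePow q ∧ IsPrimePow (q + 2) ∧ 4 * m - 1 = q * (q + 2)) :
    ∃ (G : Type) (_ : AddCommGroup G) (_ : Fintype G) (_ : DecidableEq G) (A B : Finset G),
      Fintype.card G = 4 * m - 1 ∧ IsDifferencePair A B m := by
  classical
  rcases hv with hv | ⟨q, hq, hq2, hv⟩
  · obtain ⟨F, _, _, hF⟩ := exists_field_of_isPrimePow hv
    obtain ⟨A, B, h⟩ := exists_isDifferencePair_field (F := F) (m := m) (by omega)
    exact ⟨F, inferInstance, inferInstance, inferInstance, A, B, hF, h⟩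
  · obtain ⟨F, _, _, hF⟩ := exists_field_of_isPrimePow hq
    obtain ⟨K, _, _, hK⟩ := exists_field_of_isPrimePow hq2
    have hodd : Odd q :=
      Nat.Odd.of_mul_left (n := q + 2) (hv ▸ Nat.odd_iff.mpr (by omega))
    obtain ⟨A, B, h⟩ := exists_isDifferencePair_prod (F := F) (K := K) (m := m) (hF ▸ hodd)
      (by rw [hF, hK]) (by rw [hF, hK]; omega)
    exact ⟨F × K, inferInstance, inferInstance, inferInstance, A, B,
      by rw [Fintype.card_prod, hF, hK, hv], h⟩

theorem exists_isDifferencePair_mul_prod {m : ℕ} (hm : 0 < m)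
    (hv : IsPrimePow (4 * m - 1) ∨
      ∃ q : ℕ, IsPrimePow q ∧ IsPrimePow (q + 2) ∧ 4 * m - 1 = q * (q + 2)) :
    ∀ (n : ℕ) (p : Fin n → ℕ), (∀ i, 1 < p i ∧ Odd (p i)) →
    ∃ (G : Type) (_ : AddCommGroup G) (_ : Fintype G) (_ : DecidableEq G) (A B : Finset G),
      Fintype.card G = (4 * m - 1) * ∏ i, p i ∧ IsDifferencePair A B (m * 2 ^ n) := by
  intro n
  induction n with
  | zero => simpa using exists_isDifferencePair hm hv
  | succ n ih =>
    intro p hp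
    obtain ⟨G, _, _, _, A, B, hG, h⟩ := ih (fun i => p i.castSucc) fun i => hp i.castSucc
    obtain ⟨hp1, hpodd⟩ := hp (Fin.last n)
    have : NeZero (p (Fin.last n)) := ⟨by omega⟩
    refine ⟨G × ZMod (p (Fin.last n)), inferInstance, inferInstance, inferInstance, _, _, ?_,
      (show m * 2 ^ (n + 1) = 2 * (m * 2 ^ n) by ring) ▸ h.prod_zmod hpodd hp1⟩
    rw [Fintype.card_prod, ZMod.card, hG, Fin.prod_univ_castSucc, mul_assoc]

theorem mainTheorem10 (m t n : ℕ) (hm : 0 < m)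
    (ht : (t = 1 ∧ n = 0) ∨
      ∃ p : Fin n → ℕ, (∀ i, 1 < p i ∧ Odd (p i)) ∧ t = ∏ i, p i)
    (hv : IsPrimePow (4 * m - 1) ∨
      ∃ q : ℕ, IsPrimePow q ∧ IsPrimePow (q + 2) ∧ 4 * m - 1 = q * (q + 2)) :
    GSEDFExists ((4 * m - 1) * t) 2
      ![m * 2 ^ (n + 1), (4 * m * t - t - 1) / 2] ![m * 2 ^ n, m * 2 ^ n] := by
  obtain ⟨p, hp, rfl⟩ : ∃ p : Fin n → ℕ, (∀ i, 1 < p i ∧ Odd (p i)) ∧ t = ∏ i, p i := by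
    rcases ht with ⟨rfl, rfl⟩ | ht
    · exact ⟨Fin.elim0, fun i => i.elim0, by simp⟩
    · exact ht
  obtain ⟨G, i₁, i₂, i₃, A, B, hG, h⟩ := exists_isDifferencePair_mul_prod hm hv n p hp
  refine ⟨G, i₁, i₂, i₃, ![A, B], ?_⟩
  have key := h.isGSEDF (by positivity)
  rw [hG] at key
  rwa [show m * 2 ^ (n + 1) = 2 * (m * 2 ^ n) by ring,
    show 4 * m * ∏ i, p i - ∏ i, p i - 1 = (4 * m - 1) * ∏ i, p i - 1 by
      rw [Nat.sub_mul, one_mul]]
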